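/- Consider $N$ agents $i\in\mathcal I=\{1,\dots,N\}$. Agent $i$ chooses $x_i\in\Omega_i\subseteq\mathbb R^{n_i}$ and has a cost function $J_i(x_i,x_{-i})$, where $J_i:\mathbb R^n\to\mathbb R$, $n=\sum_i n_i$, and $x=(x_1,\dots,x_N)$. A Nash equilibrium is a point $x^*\in\Omega:=\Omega_1\times\dots\times\Omega_N$ such that $J_i(x_i^*,x_{-i}^*)\le J_i(y_i,x_{-i}^*)$ for all $i$ and all $y_i\in\Omega_i$. Assume: (1) each $\Omega_i$ is non-empty, closed and convex; $J_i$ is continuous, and $J_i(\cdot,x_{-i})$ is convex and continuously differentiable on $\mathbb R^{n_i}$ for every $x_{-i}$; (2) the pseudo-gradient $F(x)=(\nabla_{x_i}J_i(x_i,x_{-i}))_{i\in\mathcal I}$ is, on $\mathbb R^n$, $\mu$-strongly monotone and $\ell_0$-Lipschitz continuous for some $\mu,\ell_0>0$; (3) $\mathcal G=(\mathcal I,\mathcal E)$ is a strongly connected digraph, where $(i,j)\in\mathcal E$ means that $i$ receives information from $j$, and $\mathcal N_i=\{j:(i,j)\in\mathcal E\}$; (4) $W=(w_{i,j})\in\mathbb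 R^{N\times N}$ is a weighted adjacency matrix of $\mathcal G$ ($w_{i,j}>0$ if $(i,j)\in\mathcal E$, $w_{i,j}=0$ otherwise), with $w_{i,i}>0$ for all $i$ and $\sum_j w_{i,j}=1$ for all $i$. Each agent $i$ keeps a vector $\boldsymbol x_i^k=(\boldsymbol x_{i,j}^k)_{j\in\mathcal I}\in\mathbb R^n$, whose $i$-th block $\boldsymbol x_{i,i}^k=x_i^k$ is its own strategy and whose other blocks $\boldsymbol x_{i,-i}^k$ are its estimates of the other agents' strategies, and a vector $\hat q_i^k\in\mathbb R^N$. Initially $x_i^0\in\Omega_i$, $\boldsymbol x_{i,-i}^0$ is arbitrary, and $\hat q_i^0=e_i$ is the $i$-th canonical basis vector. Given step sizes $(\alpha^k)_{k\in\mathbb N}$, for $k\ge 0$ and all $i$, $$\hat{\boldsymbol x}_i^k=\sum_{j\in\mathcal N_i}w_{i,j}\boldsymbol x_j^k,\qquad \hat q_i^{k+1}=\sum_{j\in\mathcal N_i}w_{i,j}\hat q_j^k,$$ $$x_i^{k+1}=\mathrm{proj}_{\Omega_i}\big(\hat{\boldsymbol x}_{i,i}^k-\alpha^k(\hat q_{i,i}^k)^{-1}\nabla_{x_i}J_i(\hat{\boldsymbol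 x}_i^k)\big),\qquad \boldsymbol x_{i,-i}^{k+1}=\hat{\boldsymbol x}_{i,-i}^k,$$ where $\mathrm{proj}_{\Omega_i}$ is the Euclidean projection onto $\Omega_i$. Let $(\alpha^k)_{k\in\mathbb N}$ be any positive nonincreasing sequence with $\sum_{k}\alpha^k=\infty$ and $\lim_{k\to\infty}\alpha^k=0$ (no bound on $\alpha^k$ in terms of the graph or of the game constants is required). Then the game has a unique Nash equilibrium $x^*$, and for every such initial condition $\boldsymbol x^k=(\boldsymbol x_i^k)_{i\in\mathcal I}$ converges to $\boldsymbol 1_N\otimes x^*$; that is, $\boldsymbol x_i^k\to x^*$ for every $i\in\mathcal I$. -/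

import Mathlib

open Filter Topology

noncomputable section

/-- Decision space `ℝ^{n i}` of agent `i`, with the Euclidean norm. -/
abbrev Strategy {N : ℕ} (n : Fin N → ℕ) (i : Fin N) : Type :=
  EuclideanSpace ℝ (Fin (n i))

/-- Collective strategies `x = col (x_1, …, x_N) ∈ ℝ^{n_1 + ⋯ + n_N}`, with the Euclidean norm. -/
abbrev Profile {N : ℕ} (n : Fin N → ℕ) : Type :=
  PiLp 2 (Strategy n)

/-- `(y, x_{-i})`: the `i`-th block of `x` is replaced by `y`. -/
def replaceBlock {N : ℕ} {n : Fin N → ℕ} (x : Profile n) (i : Fin N) (y : Strategy n i) :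
    Profile n :=
  WithLp.toLp 2 (Function.update (fun j => x j) i y)

/-- The partial gradient `∇_{x_i} f (x_i, x_{-i})`. -/
def partialGradient {N : ℕ} {n : Fin N → ℕ} (f : Profile n → ℝ) (i : Fin N) (x : Profile n) :
    Strategy n i :=
  gradient (fun y : Strategy n i => f (replaceBlock x i y)) (x i)

/-- The pseudo-gradient mapping of the game with cost functions `J i`. -/
def pseudoGradient {N : ℕ} {n : Fin N → ℕ} (J : Fin N → Profile n → ℝ) (x : Profile n) :
    Profile n :=
  WithLp.toLp 2 (fun i => partialGradient (J i) i x)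

/-- `x` is a Nash equilibrium of the game with local decision sets `Ω i` and costs `J i`. -/
def IsNashEquilibrium {N : ℕ} {n : Fin N → ℕ} (Ω : (i : Fin N) → Set (Strategy n i))
    (J : Fin N → Profile n → ℝ) (x : Profile n) : Prop :=
  (∀ i, x i ∈ Ω i) ∧ ∀ i, ∀ y ∈ Ω i, J i x ≤ J i (replaceBlock x i y)

/-- `A` is strongly monotone with constant `μ`. -/
def IsStronglyMonotone {E : Type*} [NormedAddCommGroup E] [InnerProductSpace ℝ E]
    (μ : ℝ) (A : E → E) : Prop :=
  ∀ x y, μ * ‖x - y‖ ^ 2 ≤ inner ℝ (A x - A y) (x - y)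

/-- `A` is Lipschitz continuous with constant `l`. -/
def IsLipschitz {E : Type*} [NormedAddCommGroup E] (l : ℝ) (A : E → E) : Prop :=
  ∀ x y, ‖A x - A y‖ ≤ l * ‖x - y‖

/-- `p` minimizes the distance to `x` over `S`. -/
def IsProjection {E : Type*} [NormedAddCommGroup E] (S : Set E) (x p : E) : Prop :=
  p ∈ S ∧ ∀ y ∈ S, ‖p - x‖ ≤ ‖y - x‖

/-- The Euclidean projection of `x` onto `S`: the minimizer of the distance to `x` over `S`. -/
def proj {E : Type*} [NormedAddCommGroup E] (S : Set E) (x : E) : E :=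
  Classical.epsilon (IsProjection S x)

/-- On nonempty closed convex sets the minimizer in the definition of `proj` exists. -/
theorem proj_isProjection {E : Type*} [NormedAddCommGroup E] [InnerProductSpace ℝ E]
    [CompleteSpace E] {S : Set E} (hne : S.Nonempty) (hcl : IsClosed S) (hcv : Convex ℝ S)
    (x : E) : IsProjection S x (proj S x) := by
  apply Classical.epsilon_spec
  obtain ⟨v, hv, h⟩ := exists_norm_eq_iInf_of_complete_convex hne hcl.isComplete hcv x
  refine ⟨v, hv, fun y hy => ?_⟩
  rw [norm_sub_rev v x, norm_sub_rev y x, h]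
  exact ciInf_le (f := fun w : S => ‖x - w‖)
    ⟨0, by rintro _ ⟨w, rfl⟩; exact norm_nonneg _⟩ ⟨y, hy⟩

/-- `G` is strongly connected: every ordered pair of vertices is joined by a directed path. -/
def IsStronglyConnected {V : Type*} (G : Digraph V) : Prop :=
  ∀ i j, Relation.ReflTransGen G.Adj i j

/-- `W` is a weighted adjacency matrix of `G`: positive weights on the edges, zero elsewhere. -/
def IsWeightedAdjacency {N : ℕ} (G : Digraph (Fin N)) (W : Matrix (Fin N) (Fin N) ℝ) : Prop :=
  ∀ i j, (G.Adj i j → 0 < W i j) ∧ (¬ G.Adj i j → W i j = 0)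

/-- In-neighbors of `i`: the agents `j` with `(i, j)` an edge, i.e. from which `i` can receive
information. -/
def inNeighbors {N : ℕ} (G : Digraph (Fin N)) (i : Fin N) : Finset (Fin N) :=
  open Classical in Finset.univ.filter (fun j => G.Adj i j)

/-- Online eigenvector estimates: `eigvecEstimate G W k i` is agent `i`'s estimate at time `k`,
a vector in `ℝ^N`, initialized at the `i`-th canonical basis vector. -/
def eigvecEstimate {N : ℕ} (G : Digraph (Fin N)) (W : Matrix (Fin N) (Fin N) ℝ) :
    ℕ → Fin N → (Fin N → ℝ)
  | 0 => fun i => Pi.single i 1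
  | k + 1 => fun i => ∑ j ∈ inNeighbors G i, W i j • eigvecEstimate G W k j

/-- The mixed estimate of agent `i`: the weighted sum of the estimates of its in-neighbors. -/
def mixedEstimate {N : ℕ} {n : Fin N → ℕ} (G : Digraph (Fin N)) (W : Matrix (Fin N) (Fin N) ℝ)
    (x : Fin N → Profile n) (i : Fin N) : Profile n :=
  ∑ j ∈ inNeighbors G i, W i j • x j

/-- The iterates of the pseudo-gradient algorithm with online eigenvector estimation.
`iterates … k i` is agent `i`'s estimate, at time `k`, of the collective strategy; its `i`-th block
is agent `i`'s own action. The own action takes a projected partial-gradient step, scaled by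
the reciprocal of the own entry of the eigenvector estimate; the other blocks are the mixed
estimate. -/
def iterates {N : ℕ} {n : Fin N → ℕ} (Ω : (i : Fin N) → Set (Strategy n i))
    (J : Fin N → Profile n → ℝ) (G : Digraph (Fin N)) (W : Matrix (Fin N) (Fin N) ℝ)
    (α : ℕ → ℝ) (x₀ : Fin N → Profile n) : ℕ → Fin N → Profile n
  | 0 => x₀
  | k + 1 => fun i =>
      let xhat : Profile n := mixedEstimate G W (iterates Ω J G W α x₀ k) i
      replaceBlock xhat i
        (proj (Ω i)
          (xhat i - (α k * (eigvecEstimate G W k i i)⁻¹) • partialGradient (J i) i xhat))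

end

/-! Nash equilibria are the solutions of the variational inequality of the pseudo-gradient. Strong
monotonicity makes the solution unique, and Banach's fixed point theorem for a projected gradient
map provides it.

For convergence, let `q` be the positive stationary distribution of `W` and use the energy `V k = ∑
i, q i * ‖X k i - x‖ ^ 2`, which splits into the squared distance from the `q`-mean `m` to the
equilibrium `x` plus the dispersion around `m`. Mixing by `W` keeps `m` and shrinks the dispersion
by a factor `1 - c` (`IsStationaryWeight.exists_contraction`). In the projected step agent `i` moves
only block `i`, with step `α k` divided by its estimate of `q i`; multiplied by the energy weight `q
i`, this is asymptotically `α k` for every agent. The first-order terms then add up to the full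
pseudo-gradient inner product, and strong monotonicity at `m` gives a decrease
(`exists_sum_inner_ge`).

All errors are either of order `α k` times the dispersion, absorbed by the fixed gain `c`, or `o(α
k)` times the energy. Hence eventually `V (k + 1) ≤ (1 - μ / 2 * α k) * V k`, and divergence of `∑ α
k` forces `V` to zero. Only the tail matters, so no explicit step size bound is needed. -/

/-! ### Euclidean projections. -/

theorem inner_sub_proj_nonpos {E : Type*} [NormedAddCommGroup E] [InnerProductSpace ℝ E]
    [CompleteSpace E] {S : Set E} (hne : S.Nonempty) (hcl : IsClosed S) (hcv : Convex ℝ S)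
    (x : E) {y : E} (hy : y ∈ S) : inner ℝ (x - proj S x) (y - proj S x) ≤ 0 := by
  obtain ⟨hp, hmin⟩ := proj_isProjection hne hcl hcv x
  refine (norm_eq_iInf_iff_real_inner_le_zero hcv hp).1 ?_ y hy
  have : Nonempty S := hne.to_subtype
  refine le_antisymm (le_ciInf fun w => ?_)
    (ciInf_le (f := fun w : S => ‖x - w‖) ⟨0, by rintro _ ⟨w, rfl⟩; exact norm_nonneg _⟩ ⟨_, hp⟩)
  rw [norm_sub_rev x, norm_sub_rev x]
  exact hmin w w.2

theorem proj_eq_of_inner_nonpos {E : Type*} [NormedAddCommGroup E] [InnerProductSpace ℝ E]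
    [CompleteSpace E] {S : Set E} (hcl : IsClosed S) (hcv : Convex ℝ S)
    {x p : E} (hp : p ∈ S) (h : ∀ y ∈ S, inner ℝ (x - p) (y - p) ≤ 0) : proj S x = p := by
  have hne : S.Nonempty := ⟨p, hp⟩
  have h1 := inner_sub_proj_nonpos hne hcl hcv x hp
  have h2 := h _ (proj_isProjection hne hcl hcv x).1
  have h3 : inner ℝ (proj S x - p) (proj S x - p)
      = inner ℝ (x - p) (proj S x - p) + inner ℝ (x - proj S x) (p - proj S x) := by
    rw [← neg_sub (proj S x) p, inner_neg_right, ← sub_eq_add_neg, ← inner_sub_left]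
    congr 1; abel
  have h4 : inner ℝ (proj S x - p) (proj S x - p) ≤ 0 := by linarith
  exact sub_eq_zero.1 (inner_self_eq_zero.1 (le_antisymm h4 real_inner_self_nonneg))

theorem norm_proj_sub_proj_le {E : Type*} [NormedAddCommGroup E] [InnerProductSpace ℝ E]
    [CompleteSpace E] {S : Set E} (hne : S.Nonempty) (hcl : IsClosed S) (hcv : Convex ℝ S)
    (x y : E) : ‖proj S x - proj S y‖ ≤ ‖x - y‖ := by
  have h1 := inner_sub_proj_nonpos hne hcl hcv x (proj_isProjection hne hcl hcv y).1
  have h2 := inner_sub_proj_nonpos hne hcl hcv y (proj_isProjection hne hcl hcv x).1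
  set p := proj S x
  set q := proj S y
  have h3 : inner ℝ (x - y) (p - q)
      = inner ℝ (p - q) (p - q) - inner ℝ (x - p) (q - p) - inner ℝ (y - q) (p - q) := by
    rw [← neg_sub p q, inner_neg_right, sub_neg_eq_add, ← inner_add_left, ← inner_sub_left]
    congr 1; abel
  have h4 := real_inner_le_norm (x - y) (p - q)
  rw [real_inner_self_eq_norm_sq] at h3
  by_contra! hlt
  nlinarith [norm_nonneg (x - y), norm_nonneg (p - q)]

theorem norm_sub_sq_le_two_mul {E : Type*} [SeminormedAddCommGroup E] (x y z : E) :
    ‖x - z‖ ^ 2 ≤ 2 * ‖x - y‖ ^ 2 + 2 * ‖y - z‖ ^ 2 := by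
  have h := norm_sub_le_norm_sub_add_norm_sub x y z
  nlinarith [sq_nonneg (‖x - y‖ - ‖y - z‖), norm_nonneg (x - z)]

/-! ### Weighted consensus and stationary distributions. -/

section Consensus

variable {ι E : Type*} [Fintype ι] [NormedAddCommGroup E] [InnerProductSpace ℝ E]

theorem sum_mul_norm_sub_mean_sq {p : ι → ℝ} (hp : ∑ i, p i = 1) (x : ι → E) :
    ∑ i, p i * ‖x i - ∑ j, p j • x j‖ ^ 2
      = ∑ i, p i * ‖x i‖ ^ 2 - ‖∑ j, p j • x j‖ ^ 2 := by
  set m := ∑ j, p j • x j with hm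
  have h1 : ∑ i, p i * inner ℝ (x i) m = ‖m‖ ^ 2 := by
    rw [← real_inner_self_eq_norm_sq]
    conv_rhs => rw [hm, sum_inner]
    exact Finset.sum_congr rfl fun i _ => (real_inner_smul_left _ _ _).symm
  calc ∑ i, p i * ‖x i - m‖ ^ 2
      = ∑ i, (p i * ‖x i‖ ^ 2 - 2 * (p i * inner ℝ (x i) m) + p i * ‖m‖ ^ 2) :=
        Finset.sum_congr rfl fun i _ => by rw [norm_sub_sq_real]; ring
    _ = _ := by
        rw [Finset.sum_add_distrib, Finset.sum_sub_distrib, ← Finset.mul_sum, h1,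
          ← Finset.sum_mul, hp]
        ring

/-- A positive stationary distribution `q` of the row-stochastic matrix `W`. -/
structure IsStationaryWeight (W : Matrix ι ι ℝ) (q : ι → ℝ) : Prop where
  pos : ∀ i, 0 < q i
  sum_eq : ∑ i, q i = 1
  stationary : ∀ j, ∑ i, q i * W i j = q j

theorem IsStationaryWeight.mean_step {W : Matrix ι ι ℝ} {q : ι → ℝ} (hq : IsStationaryWeight W q)
    (x : ι → E) : ∑ i, q i • ∑ j, W i j • x j = ∑ j, q j • x j := by
  simp_rw [Finset.smul_sum, smul_smul]
  rw [Finset.sum_comm]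
  simp_rw [← Finset.sum_smul, hq.stationary]

/-- The variance identity in each row of `W`, summed with weights `q`; stationarity turns the
averaged second moments back into the original ones. The subtracted term is the energy dissipated by
one mixing step. -/
theorem IsStationaryWeight.sum_mul_norm_step_sq {W : Matrix ι ι ℝ} {q : ι → ℝ} (hq : IsStationaryWeight W q)
    (hrow : ∀ i, ∑ j, W i j = 1) (x : ι → E) :
    ∑ i, q i * ‖∑ j, W i j • x j‖ ^ 2 = ∑ i, q i * ‖x i‖ ^ 2
      - ∑ i, q i * ∑ j, W i j * ‖x j - ∑ l, W i l • x l‖ ^ 2 := by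
  simp_rw [sum_mul_norm_sub_mean_sq (hrow _), mul_sub, Finset.sum_sub_distrib, Finset.mul_sum]
  rw [Finset.sum_comm (f := fun i j => q i * (W i j * ‖x j‖ ^ 2))]
  simp_rw [← mul_assoc, ← Finset.sum_mul, hq.stationary]
  ring

/-- Dissipation controls disagreement along paths. On an edge from `a` to `b`, both `x a` (by the
self-loop) and `x b` are close to the average formed at `a`, hence to each other. -/
theorem IsStationaryWeight.exists_norm_sub_sq_le {W : Matrix ι ι ℝ} {q : ι → ℝ}
    (hq : IsStationaryWeight W q) (hnn : ∀ i j, 0 ≤ W i j) (hdiag : ∀ i, 0 < W i i)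
    {i j : ι} (hij : Relation.ReflTransGen (fun a b => 0 < W a b) i j) :
    ∃ C : ℝ, 0 ≤ C ∧ ∀ x : ι → E, ‖x i - x j‖ ^ 2
      ≤ C * ∑ a, q a * ∑ b, W a b * ‖x b - ∑ l, W a l • x l‖ ^ 2 := by
  have key : ∀ (x : ι → E) (a b : ι), q a * (W a b * ‖x b - ∑ l, W a l • x l‖ ^ 2)
      ≤ ∑ a, q a * ∑ b, W a b * ‖x b - ∑ l, W a l • x l‖ ^ 2 := fun x a b =>
    (mul_le_mul_of_nonneg_left (Finset.single_le_sum
      (f := fun b => W a b * ‖x b - ∑ l, W a l • x l‖ ^ 2)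
      (fun b _ => mul_nonneg (hnn a b) (sq_nonneg _)) (Finset.mem_univ b)) (hq.pos a).le).trans
    (Finset.single_le_sum (f := fun a => q a * ∑ b, W a b * ‖x b - ∑ l, W a l • x l‖ ^ 2)
      (fun a _ => mul_nonneg (hq.pos a).le
        (Finset.sum_nonneg fun b _ => mul_nonneg (hnn a b) (sq_nonneg _))) (Finset.mem_univ a))
  induction hij with
  | refl => exact ⟨0, le_rfl, fun x => by simp⟩
  | @tail a b _ hab ih =>
    obtain ⟨C, hC, h⟩ := ih
    have ha := hq.pos a
    have haa := hdiag a
    refine ⟨2 * C + 2 * (2 * (q a * W a a)⁻¹ + 2 * (q a * W a b)⁻¹), by positivity, fun x => ?_⟩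
    have h0 := norm_sub_sq_le_two_mul (x i) (x a) (x b)
    have h1 := norm_sub_sq_le_two_mul (x a) (∑ l, W a l • x l) (x b)
    rw [norm_sub_rev (∑ l, W a l • x l) (x b)] at h1
    have h2 := (le_inv_mul_iff₀ (mul_pos ha haa)).2 ((mul_assoc _ _ _).trans_le (key x a a))
    have h3 := (le_inv_mul_iff₀ (mul_pos ha hab)).2 ((mul_assoc _ _ _).trans_le (key x a b))
    have h4 := h x
    linarith

theorem IsStationaryWeight.exists_contraction {W : Matrix ι ι ℝ} {q : ι → ℝ} (hq : IsStationaryWeight W q)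
    (hnn : ∀ i j, 0 ≤ W i j) (hdiag : ∀ i, 0 < W i i) (hrow : ∀ i, ∑ j, W i j = 1)
    (hconn : ∀ i j, Relation.ReflTransGen (fun a b => 0 < W a b) i j) :
    ∃ c : ℝ, 0 < c ∧ c ≤ 1 ∧ ∀ x : ι → E,
      ∑ i, q i * ‖∑ j, W i j • x j - ∑ j, q j • x j‖ ^ 2
        ≤ (1 - c) * ∑ i, q i * ‖x i - ∑ j, q j • x j‖ ^ 2 := by
  choose C hC hCx using fun i j => hq.exists_norm_sub_sq_le (E := E) hnn hdiag (hconn i j)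
  -- The summand 1 makes `B⁻¹` an admissible contraction constant, at most 1.
  set B : ℝ := 1 + ∑ i, ∑ j, C i j with hB
  have hB1 : 1 ≤ B := by
    have : 0 ≤ ∑ i, ∑ j, C i j := Finset.sum_nonneg fun i _ => Finset.sum_nonneg fun j _ => hC i j
    linarith
  refine ⟨B⁻¹, by positivity, inv_le_one_of_one_le₀ hB1, fun x => ?_⟩
  set D := ∑ a, q a * ∑ b, W a b * ‖x b - ∑ l, W a l • x l‖ ^ 2 with hD
  have hD0 : 0 ≤ D := Finset.sum_nonneg fun a _ => mul_nonneg (hq.pos a).le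
    (Finset.sum_nonneg fun b _ => mul_nonneg (hnn a b) (sq_nonneg _))
  have hCB : ∀ i j, C i j ≤ B := fun i j => by
    have h1 := Finset.single_le_sum (f := fun j => C i j) (fun j _ => hC i j) (Finset.mem_univ j)
    have h2 := Finset.single_le_sum (f := fun i => ∑ j, C i j)
      (fun i _ => Finset.sum_nonneg fun j _ => hC i j) (Finset.mem_univ i)
    linarith
  have hpair : ∀ i j, ‖x i - x j‖ ^ 2 ≤ B * D := fun i j =>
    (hCx i j x).trans (mul_le_mul_of_nonneg_right (hCB i j) hD0)
  have hmean : ∀ i, ‖x i - ∑ j, q j • x j‖ ^ 2 ≤ B * D := fun i => by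
    have h1 := sum_mul_norm_sub_mean_sq hq.sum_eq (fun j => x i - x j)
    have h2 : ∑ j, q j • (x i - x j) = x i - ∑ j, q j • x j := by
      simp_rw [smul_sub, Finset.sum_sub_distrib, ← Finset.sum_smul, hq.sum_eq, one_smul]
    have h3 : 0 ≤ ∑ j, q j * ‖x i - x j - ∑ j, q j • (x i - x j)‖ ^ 2 :=
      Finset.sum_nonneg fun j _ => mul_nonneg (hq.pos j).le (sq_nonneg _)
    have h4 : ∑ j, q j * ‖x i - x j‖ ^ 2 ≤ ∑ j, q j * (B * D) :=
      Finset.sum_le_sum fun j _ => mul_le_mul_of_nonneg_left (hpair i j) (hq.pos j).le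
    rw [← Finset.sum_mul, hq.sum_eq, one_mul] at h4
    rw [← h2]
    linarith
  have hP : ∑ i, q i * ‖x i - ∑ j, q j • x j‖ ^ 2 ≤ B * D := by
    calc _ ≤ ∑ i, q i * (B * D) :=
          Finset.sum_le_sum fun j _ => mul_le_mul_of_nonneg_left (hmean j) (hq.pos j).le
      _ = _ := by rw [← Finset.sum_mul, hq.sum_eq, one_mul]
  have h5 := sum_mul_norm_sub_mean_sq hq.sum_eq (fun i => ∑ j, W i j • x j)
  rw [hq.mean_step, hq.sum_mul_norm_step_sq hrow, ← hD] at h5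
  have h6 := sum_mul_norm_sub_mean_sq hq.sum_eq x
  have h7 : B⁻¹ * ∑ i, q i * ‖x i - ∑ j, q j • x j‖ ^ 2 ≤ D :=
    (inv_mul_le_iff₀ (by positivity)).2 hP
  linarith

/-- Perron–Frobenius by hand: the constant vector is fixed by `W`, so some nonzero `u` is fixed from
the left. The triangle inequality bounds `|u|` entrywise by its image, with equal totals because
rows sum to 1, so `|u|` is fixed too; connectivity spreads positivity to every entry. -/
theorem exists_isStationaryWeight [DecidableEq ι] [Nonempty ι] {W : Matrix ι ι ℝ}
    (hnn : ∀ i j, 0 ≤ W i j) (hrow : ∀ i, ∑ j, W i j = 1)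
    (hconn : ∀ i j, Relation.ReflTransGen (fun a b => 0 < W a b) i j) :
    ∃ q : ι → ℝ, IsStationaryWeight W q := by
  have hker : ∃ v : ι → ℝ, v ≠ 0 ∧ (W - 1).mulVec v = 0 := by
    refine ⟨fun _ => 1, fun h => one_ne_zero (congrFun h (Classical.arbitrary ι)), ?_⟩
    ext i
    simp [Matrix.mulVec, dotProduct, hrow, Matrix.one_apply]
  rw [Matrix.exists_mulVec_eq_zero_iff, ← Matrix.exists_vecMul_eq_zero_iff] at hker
  obtain ⟨u, hu0, hu⟩ := hker
  have hu' : ∀ j, ∑ i, u i * W i j = u j := fun j => by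
    have h := congrFun hu j
    rw [Matrix.vecMul_sub, Matrix.vecMul_one] at h
    exact sub_eq_zero.1 h
  have hle : ∀ j, |u j| ≤ ∑ i, |u i| * W i j := fun j => by
    calc |u j| = |∑ i, u i * W i j| := by rw [hu']
      _ ≤ ∑ i, |u i * W i j| := Finset.abs_sum_le_sum_abs _ _
      _ = _ := Finset.sum_congr rfl fun i _ => by rw [abs_mul, abs_of_nonneg (hnn i j)]
  have hsum : ∑ j, |u j| = ∑ j, ∑ i, |u i| * W i j := by
    rw [Finset.sum_comm]
    simp_rw [← Finset.mul_sum, hrow, mul_one]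
  have heq : ∀ j, ∑ i, |u i| * W i j = |u j| := fun j =>
    ((Finset.sum_eq_sum_iff_of_le fun j _ => hle j).1 hsum j (Finset.mem_univ j)).symm
  obtain ⟨i₀, hi₀⟩ := Function.ne_iff.1 hu0
  have hpos : ∀ j, 0 < |u j| := fun j => by
    induction hconn i₀ j with
    | refl => exact abs_pos.2 hi₀
    | @tail a b _ hab ih =>
      rw [← heq b]
      exact (mul_pos ih hab).trans_le (Finset.single_le_sum (f := fun i => |u i| * W i b)
        (fun i _ => mul_nonneg (abs_nonneg _) (hnn i b)) (Finset.mem_univ a))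
  have hS : 0 < ∑ i, |u i| := Finset.sum_pos (fun i _ => hpos i) Finset.univ_nonempty
  refine ⟨fun i => |u i| / ∑ i, |u i|, fun i => div_pos (hpos i) hS, ?_, fun j => ?_⟩
  · rw [← Finset.sum_div, div_self hS.ne']
  · simp_rw [div_mul_eq_mul_div, ← Finset.sum_div, heq]

end Consensus

/-! ### Convergence of averaging and of the eigenvector estimates. -/

theorem sum_inNeighbors_smul {N : ℕ} {E : Type*} [AddCommGroup E] [Module ℝ E]
    {G : Digraph (Fin N)} {W : Matrix (Fin N) (Fin N) ℝ} (hW : IsWeightedAdjacency G W)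
    (x : Fin N → E) (i : Fin N) : ∑ j ∈ inNeighbors G i, W i j • x j = ∑ j, W i j • x j := by
  refine Finset.sum_subset (Finset.subset_univ _) fun j _ hj => ?_
  have : ¬ G.Adj i j := by simpa [inNeighbors] using hj
  rw [(hW i j).2 this, zero_smul]

theorem IsStationaryWeight.tendsto_mean {ι E : Type*} [Fintype ι] [NormedAddCommGroup E]
    [InnerProductSpace ℝ E] {W : Matrix ι ι ℝ} {q : ι → ℝ} (hq : IsStationaryWeight W q)
    (hnn : ∀ i j, 0 ≤ W i j) (hdiag : ∀ i, 0 < W i i) (hrow : ∀ i, ∑ j, W i j = 1)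
    (hconn : ∀ i j, Relation.ReflTransGen (fun a b => 0 < W a b) i j) (v : ℕ → ι → E)
    (hstep : ∀ k i, v (k + 1) i = ∑ l, W i l • v k l) (i : ι) :
    Tendsto (fun k => v k i) atTop (𝓝 (∑ j, q j • v 0 j)) := by
  obtain ⟨c, hc0, hc1, hc⟩ := hq.exists_contraction (E := E) hnn hdiag hrow hconn
  obtain ⟨m, hm⟩ : ∃ m, m = ∑ j, q j • v 0 j := ⟨_, rfl⟩
  rw [← hm]
  have hmean : ∀ k, ∑ i, q i • v k i = m := fun k => by
    induction k with
    | zero => exact hm.symm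
    | succ k ih => simp_rw [hstep, hq.mean_step, ih]
  have hdecay : ∀ k, ∑ i, q i * ‖v k i - m‖ ^ 2
      ≤ (1 - c) ^ k * ∑ i, q i * ‖v 0 i - m‖ ^ 2 := fun k => by
    induction k with
    | zero => simp
    | succ k ih =>
      have h := hc (v k)
      rw [hmean k] at h
      simp_rw [← hstep] at h
      rw [pow_succ', mul_assoc]
      exact h.trans (mul_le_mul_of_nonneg_left ih (by linarith))
  have hlim : Tendsto (fun k => (q i)⁻¹ * ((1 - c) ^ k * ∑ i, q i * ‖v 0 i - m‖ ^ 2))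
      atTop (𝓝 0) := by
    have h := tendsto_pow_atTop_nhds_zero_of_lt_one (r := 1 - c) (by linarith) (by linarith)
    simpa using (h.mul_const (∑ i, q i * ‖v 0 i - m‖ ^ 2)).const_mul (q i)⁻¹
  have hsq : Tendsto (fun k => ‖v k i - m‖ ^ 2) atTop (𝓝 0) := by
    refine squeeze_zero (fun k => sq_nonneg _) (fun k => ?_) hlim
    rw [le_inv_mul_iff₀ (hq.pos i)]
    exact (Finset.single_le_sum (f := fun i => q i * ‖v k i - m‖ ^ 2)
      (fun i _ => mul_nonneg (hq.pos i).le (sq_nonneg _)) (Finset.mem_univ i)).trans (hdecay k)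
  rw [tendsto_iff_norm_sub_tendsto_zero]
  simpa using hsq.sqrt

theorem tendsto_eigvecEstimate {N : ℕ} {G : Digraph (Fin N)} {W : Matrix (Fin N) (Fin N) ℝ}
    {q : Fin N → ℝ} (hW : IsWeightedAdjacency G W) (hq : IsStationaryWeight W q)
    (hnn : ∀ i j, 0 ≤ W i j) (hdiag : ∀ i, 0 < W i i) (hrow : ∀ i, ∑ j, W i j = 1)
    (hconn : ∀ i j, Relation.ReflTransGen (fun a b => 0 < W a b) i j) (i j : Fin N) :
    Tendsto (fun k => eigvecEstimate G W k i j) atTop (𝓝 (q j)) := by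
  -- For fixed `j`, the `j`-th entries perform scalar consensus from the initial values `e_i` at
  -- `j`, whose `q`-mean is `q j`.
  have h := hq.tendsto_mean hnn hdiag hrow hconn (fun k i => eigvecEstimate G W k i j)
    (fun k i => by
      simp only [eigvecEstimate]
      rw [sum_inNeighbors_smul hW, Finset.sum_apply]
      rfl) i
  simpa [eigvecEstimate, Pi.single_apply] using h

/-! ### A scalar recursion with divergent step sum. -/

theorem tendsto_zero_of_eventually_le_one_sub_mul {V α : ℕ → ℝ} {β : ℝ} (hβ : 0 < β)
    (hV : ∀ k, 0 ≤ V k) (hstep : ∀ᶠ k in atTop, V (k + 1) ≤ (1 - β * α k) * V k)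
    (hα : Tendsto (fun K => ∑ k ∈ Finset.range K, α k) atTop atTop) :
    Tendsto V atTop (𝓝 0) := by
  obtain ⟨K, hK⟩ := eventually_atTop.1 hstep
  set A : ℕ → ℝ := fun m => ∑ k ∈ Finset.range m, α k with hA
  have hbound : ∀ k ≥ K, V k ≤ V K * Real.exp (-(β * (A k - A K))) := fun k hk => by
    induction k, hk using Nat.le_induction with
    | base => simp
    | succ k hk ih =>
      have h1 : 1 - β * α k ≤ Real.exp (-(β * α k)) := by
        linarith [Real.add_one_le_exp (-(β * α k))]
      have h2 : A (k + 1) = A k + α k := Finset.sum_range_succ _ _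
      calc V (k + 1) ≤ (1 - β * α k) * V k := hK k hk
        _ ≤ Real.exp (-(β * α k)) * V k := mul_le_mul_of_nonneg_right h1 (hV k)
        _ ≤ Real.exp (-(β * α k)) * (V K * Real.exp (-(β * (A k - A K)))) :=
          mul_le_mul_of_nonneg_left ih (Real.exp_nonneg _)
        _ = _ := by
          rw [h2, mul_left_comm, ← Real.exp_add]
          ring_nf
  have hlim : Tendsto (fun k => V K * Real.exp (-(β * (A k - A K)))) atTop (𝓝 0) := by
    have h1 : Tendsto (fun k => β * (A k - A K)) atTop atTop :=
      (tendsto_atTop_add_const_right _ (-A K) hα).const_mul_atTop hβ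
    simpa using (Real.tendsto_exp_neg_atTop_nhds_zero.comp h1).const_mul (V K)
  exact tendsto_of_tendsto_of_tendsto_of_le_of_le' tendsto_const_nhds hlim
    (Eventually.of_forall hV) (eventually_atTop.2 ⟨K, hbound⟩)

/-! ### First-order conditions for convex minimization. -/

section Convex

variable {E : Type*} [NormedAddCommGroup E] [InnerProductSpace ℝ E] [CompleteSpace E]

theorem ConvexOn.inner_gradient_sub_le {f : E → ℝ} (hf : ConvexOn ℝ Set.univ f) {x : E}
    (hd : DifferentiableAt ℝ f x) (y : E) : inner ℝ (gradient f x) (y - x) ≤ f y - f x := by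
  have hline : HasDerivAt (fun t : ℝ => f (AffineMap.lineMap x y t))
      (inner ℝ (gradient f x) (y - x)) 0 := by
    have h1 : HasFDerivAt f (InnerProductSpace.toDual ℝ E (gradient f x))
        (AffineMap.lineMap x y (0 : ℝ)) := by
      rw [AffineMap.lineMap_apply_zero]
      exact hd.hasGradientAt.hasFDerivAt
    have h2 := h1.comp_hasDerivAt (0 : ℝ) (AffineMap.hasDerivAt_lineMap (a := x) (b := y))
    simpa [Function.comp_def] using h2
  have hconv : ConvexOn ℝ Set.univ (fun t : ℝ => f (AffineMap.lineMap x y t)) := by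
    simpa [Function.comp_def] using hf.comp_affineMap (AffineMap.lineMap x y : ℝ →ᵃ[ℝ] E)
  have h := hconv.le_slope_of_hasDerivAt (Set.mem_univ 0) (Set.mem_univ 1) zero_lt_one hline
  simpa [slope_def_field] using h

theorem inner_gradient_sub_nonneg_of_isMinOn {f : E → ℝ} {S : Set E} (hS : Convex ℝ S) {x y : E}
    (hd : DifferentiableAt ℝ f x) (hmin : IsMinOn f S x) (hx : x ∈ S) (hy : y ∈ S) :
    0 ≤ inner ℝ (gradient f x) (y - x) := by
  have h := hmin.localize.hasFDerivWithinAt_nonneg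
    hd.hasGradientAt.hasFDerivAt.hasFDerivWithinAt
    (sub_mem_posTangentConeAt_of_segment_subset (hS.segment_subset hx hy))
  simpa using h

end Convex

/-! ### Games, variational inequalities and one-step estimates. -/

section Game

variable {N : ℕ} {n : Fin N → ℕ}

@[simp] theorem replaceBlock_apply_self (x : Profile n) (i : Fin N) (y : Strategy n i) :
    replaceBlock x i y i = y := by
  simp [replaceBlock]

theorem replaceBlock_apply_of_ne (x : Profile n) {i j : Fin N} (h : j ≠ i) (y : Strategy n i) :
    replaceBlock x i y j = x j := by
  simp [replaceBlock, h]

@[simp] theorem replaceBlock_eq_self (x : Profile n) (i : Fin N) :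
    replaceBlock x i (x i) = x := by
  ext1 j
  by_cases h : j = i
  · subst h; simp
  · exact replaceBlock_apply_of_ne x h _

theorem norm_replaceBlock_sub_sq (z w : Profile n) (i : Fin N) (y : Strategy n i) :
    ‖replaceBlock z i y - w‖ ^ 2 = ‖z - w‖ ^ 2 - ‖z i - w i‖ ^ 2 + ‖y - w i‖ ^ 2 := by
  rw [PiLp.norm_sq_eq_of_L2, PiLp.norm_sq_eq_of_L2,
    ← Finset.add_sum_erase _ _ (Finset.mem_univ i),
    ← Finset.add_sum_erase Finset.univ (fun j => ‖(z - w) j‖ ^ 2) (Finset.mem_univ i)]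
  have : ∑ j ∈ Finset.univ.erase i, ‖(replaceBlock z i y - w) j‖ ^ 2
      = ∑ j ∈ Finset.univ.erase i, ‖(z - w) j‖ ^ 2 :=
    Finset.sum_congr rfl fun j hj => by
      rw [PiLp.sub_apply, PiLp.sub_apply, replaceBlock_apply_of_ne _ (Finset.ne_of_mem_erase hj)]
  rw [this, PiLp.sub_apply, PiLp.sub_apply, replaceBlock_apply_self]
  ring

/-- `x` solves the variational inequality of `F` over the product of the sets `Ω i`. -/
def IsVISolution (Ω : (i : Fin N) → Set (Strategy n i)) (F : Profile n → Profile n)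
    (x : Profile n) : Prop :=
  (∀ i, x i ∈ Ω i) ∧ ∀ i, ∀ y ∈ Ω i, 0 ≤ inner ℝ (F x i) (y - x i)

theorem isNashEquilibrium_iff_isVISolution {Ω : (i : Fin N) → Set (Strategy n i)}
    {J : Fin N → Profile n → ℝ} (hΩ_convex : ∀ i, Convex ℝ (Ω i))
    (hJ_convex : ∀ i (x : Profile n),
      ConvexOn ℝ Set.univ (fun y : Strategy n i => J i (replaceBlock x i y)))
    (hJ_diff : ∀ i (x : Profile n),
      ContDiff ℝ 1 (fun y : Strategy n i => J i (replaceBlock x i y))) (x : Profile n) :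
    IsNashEquilibrium Ω J x ↔ IsVISolution Ω (pseudoGradient J) x := by
  have hd : ∀ i, DifferentiableAt ℝ (fun y : Strategy n i => J i (replaceBlock x i y)) (x i) :=
    fun i => ((hJ_diff i x).differentiable one_ne_zero).differentiableAt
  refine and_congr_right fun hx => forall_congr' fun i => ⟨fun h y hy => ?_, fun h y hy => ?_⟩
  · refine inner_gradient_sub_nonneg_of_isMinOn (hΩ_convex i) (hd i) (fun w hw => ?_) (hx i) hy
    simpa using h w hw
  · have h1 := (hJ_convex i x).inner_gradient_sub_le (hd i) y
    have h2 : 0 ≤ inner ℝ (gradient (fun y : Strategy n i => J i (replaceBlock x i y)) (x i))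
      (y - x i) := h y hy
    simp only [replaceBlock_eq_self] at h1
    linarith

variable {Ω : (i : Fin N) → Set (Strategy n i)} {F : Profile n → Profile n} {μ l : ℝ}

theorem IsVISolution.eq (hμ : 0 < μ) (hF : IsStronglyMonotone μ F)
    {x y : Profile n} (hx : IsVISolution Ω F x) (hy : IsVISolution Ω F y) : x = y := by
  have h1 : inner ℝ (F x - F y) (x - y) ≤ 0 := by
    rw [PiLp.inner_apply]
    refine Finset.sum_nonpos fun i _ => ?_
    have h2 := hx.2 i _ (hy.1 i)
    have h3 := hy.2 i _ (hx.1 i)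
    rw [← neg_sub (x i) (y i), inner_neg_right] at h2
    rw [PiLp.sub_apply, PiLp.sub_apply, inner_sub_left]
    linarith
  have h4 := hF x y
  have h5 : ‖x - y‖ ^ 2 ≤ 0 := by
    by_contra! h
    linarith [mul_pos hμ h]
  have h6 : ‖x - y‖ = 0 := pow_eq_zero_iff two_ne_zero |>.1 (le_antisymm h5 (sq_nonneg _))
  exact sub_eq_zero.1 (norm_eq_zero.1 h6)

theorem IsVISolution.proj_eq (hcl : ∀ i, IsClosed (Ω i)) (hcv : ∀ i, Convex ℝ (Ω i))
    {x : Profile n} (hx : IsVISolution Ω F x) {s : ℝ} (hs : 0 ≤ s) (i : Fin N) :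
    proj (Ω i) (x i - s • F x i) = x i := by
  refine proj_eq_of_inner_nonpos (hcl i) (hcv i) (hx.1 i) fun y hy => ?_
  rw [sub_sub_cancel_left, inner_neg_left, real_inner_smul_left]
  exact neg_nonpos.2 (mul_nonneg hs (hx.2 i y hy))

theorem exists_isVISolution (hne : ∀ i, (Ω i).Nonempty) (hcl : ∀ i, IsClosed (Ω i))
    (hcv : ∀ i, Convex ℝ (Ω i)) (hμ : 0 < μ) (hl : 0 < l) (hF : IsStronglyMonotone μ F)
    (hL : IsLipschitz l F) : ∃ x, IsVISolution Ω F x := by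
  -- Enlarging the Lipschitz constant gives `μ ≤ L` for free, so the squared contraction factor `1 -
  -- μ ^ 2 / L ^ 2` is nonnegative; `γ = μ / L ^ 2` is the step that yields this factor.
  set L := l + μ with hLdef
  have hLpos : 0 < L := by positivity
  set γ := μ / L ^ 2 with hγ
  have hγpos : 0 < γ := by positivity
  set T : Profile n → Profile n := fun x =>
    WithLp.toLp 2 (fun i => proj (Ω i) (x i - γ • F x i)) with hT
  have hk0 : 0 ≤ 1 - μ ^ 2 / L ^ 2 := by
    rw [sub_nonneg, div_le_one (by positivity)]
    exact pow_le_pow_left₀ hμ.le (by linarith) 2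
  have hk1 : 1 - μ ^ 2 / L ^ 2 < 1 := by
    have : 0 < μ ^ 2 / L ^ 2 := by positivity
    linarith
  have hcontr : ∀ x y, ‖T x - T y‖ ^ 2 ≤ (1 - μ ^ 2 / L ^ 2) * ‖x - y‖ ^ 2 := fun x y => by
    have h1 : ‖T x - T y‖ ^ 2 ≤ ‖(x - y) - γ • (F x - F y)‖ ^ 2 := by
      rw [PiLp.norm_sq_eq_of_L2, PiLp.norm_sq_eq_of_L2]
      refine Finset.sum_le_sum fun i _ => pow_le_pow_left₀ (norm_nonneg _) ?_ 2
      refine (norm_proj_sub_proj_le (hne i) (hcl i) (hcv i) _ _).trans_eq ?_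
      congr 1
      simp only [PiLp.sub_apply, PiLp.smul_apply, smul_sub]
      abel
    rw [norm_sub_sq_real (x - y), real_inner_smul_right, norm_smul, mul_pow, real_inner_comm,
      Real.norm_of_nonneg hγpos.le] at h1
    have h2 := hF x y
    have h3 : ‖F x - F y‖ ^ 2 ≤ L ^ 2 * ‖x - y‖ ^ 2 := by
      rw [← mul_pow]
      exact pow_le_pow_left₀ (norm_nonneg _)
        ((hL x y).trans (mul_le_mul_of_nonneg_right (by linarith) (norm_nonneg _))) 2
    have h4 := mul_le_mul_of_nonneg_left h2 hγpos.le
    have h5 := mul_le_mul_of_nonneg_left h3 (sq_nonneg γ)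
    have h6 : γ * (μ * ‖x - y‖ ^ 2) = μ ^ 2 / L ^ 2 * ‖x - y‖ ^ 2 := by rw [hγ]; ring
    have h7 : γ ^ 2 * (L ^ 2 * ‖x - y‖ ^ 2) = μ ^ 2 / L ^ 2 * ‖x - y‖ ^ 2 := by
      rw [hγ]; field_simp
    linarith
  have hT' : ContractingWith (Real.toNNReal (√(1 - μ ^ 2 / L ^ 2))) T := by
    refine ⟨?_, LipschitzWith.of_dist_le_mul fun x y => ?_⟩
    · rw [Real.toNNReal_lt_one, Real.sqrt_lt' one_pos]
      simpa using hk1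
    · rw [dist_eq_norm, dist_eq_norm, Real.coe_toNNReal _ (Real.sqrt_nonneg _)]
      refine (pow_le_pow_iff_left₀ (norm_nonneg _) (by positivity) two_ne_zero).1 ?_
      rw [mul_pow, Real.sq_sqrt hk0]
      exact hcontr x y
  have hfix : T hT'.fixedPoint = hT'.fixedPoint := hT'.fixedPoint_isFixedPt
  set x := hT'.fixedPoint
  have hfix' : ∀ i, proj (Ω i) (x i - γ • F x i) = x i := fun i => by
    conv_rhs => rw [← hfix]
  refine ⟨x, fun i => ?_, fun i y hy => ?_⟩
  · rw [← hfix' i]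
    exact (proj_isProjection (hne i) (hcl i) (hcv i) _).1
  · have h := inner_sub_proj_nonpos (hne i) (hcl i) (hcv i) (x i - γ • F x i) hy
    rw [hfix' i, sub_sub_cancel_left, inner_neg_left, real_inner_smul_left] at h
    exact (mul_nonneg_iff_of_pos_left hγpos).1 (by linarith)

theorem IsLipschitz.norm_block_sub_le (hL : IsLipschitz l F) (x y : Profile n) (i : Fin N) :
    ‖F x i - F y i‖ ≤ l * ‖x - y‖ :=
  (PiLp.norm_apply_le (F x - F y) i).trans (hL x y)

theorem norm_apply_sub_apply_le (x y : Profile n) (i : Fin N) : ‖x i - y i‖ ≤ ‖x - y‖ :=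
  PiLp.norm_apply_le (x - y) i

/-- The block `x i` is fixed by the projected step of the same length, and projections are
nonexpansive. As only block `i` moves, the cross term involves that block alone. -/
theorem IsVISolution.norm_step_sub_sq_le (hne : ∀ i, (Ω i).Nonempty)
    (hcl : ∀ i, IsClosed (Ω i)) (hcv : ∀ i, Convex ℝ (Ω i)) (hL : IsLipschitz l F)
    {x : Profile n} (hx : IsVISolution Ω F x) {s : ℝ} (hs : 0 ≤ s) (z : Profile n) (i : Fin N) :
    ‖replaceBlock z i (proj (Ω i) (z i - s • F z i)) - x‖ ^ 2
      ≤ ‖z - x‖ ^ 2 - 2 * s * inner ℝ (z i - x i) (F z i - F x i)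
        + s ^ 2 * (l ^ 2 * ‖z - x‖ ^ 2) := by
  rw [norm_replaceBlock_sub_sq]
  have h1 : ‖proj (Ω i) (z i - s • F z i) - x i‖ ^ 2
      ≤ ‖(z i - x i) - s • (F z i - F x i)‖ ^ 2 := by
    refine pow_le_pow_left₀ (norm_nonneg _) ?_ 2
    conv_lhs => rw [← hx.proj_eq hcl hcv hs i]
    refine (norm_proj_sub_proj_le (hne i) (hcl i) (hcv i) _ _).trans_eq ?_
    congr 1
    rw [smul_sub]
    abel
  rw [norm_sub_sq_real (z i - x i), real_inner_smul_right, norm_smul, mul_pow,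
    Real.norm_of_nonneg hs] at h1
  have h2 : ‖F z i - F x i‖ ^ 2 ≤ l ^ 2 * ‖z - x‖ ^ 2 := by
    rw [← mul_pow]
    exact pow_le_pow_left₀ (norm_nonneg _) (hL.norm_block_sub_le z x i) 2
  have h3 := mul_le_mul_of_nonneg_left h2 (sq_nonneg s)
  linarith

/-- Replaces the local point `z` by the common mean `m`; Young's inequality with parameter `δ`
charges most of the error to `‖z - m‖ ^ 2`. -/
theorem IsLipschitz.inner_block_perturb (hl : 0 ≤ l) (hL : IsLipschitz l F)
    (x m z : Profile n) (i : Fin N) {δ : ℝ} (hδ : 0 < δ) :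
    inner ℝ (m i - x i) (F m i - F x i) - δ * ‖m - x‖ ^ 2 - (l ^ 2 / δ + l) * ‖z - m‖ ^ 2
      ≤ inner ℝ (z i - x i) (F z i - F x i) := by
  have hsplit : inner ℝ (z i - x i) (F z i - F x i) = inner ℝ (m i - x i) (F m i - F x i)
      + inner ℝ (m i - x i) (F z i - F m i) + inner ℝ (z i - m i) (F z i - F x i) := by
    rw [← inner_add_right, sub_add_sub_cancel', ← inner_add_left, sub_add_sub_cancel']
  have h1 : -(‖m - x‖ * (l * ‖z - m‖)) ≤ inner ℝ (m i - x i) (F z i - F m i) :=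
    (neg_le_neg ((abs_real_inner_le_norm _ _).trans (mul_le_mul (norm_apply_sub_apply_le m x i)
      (hL.norm_block_sub_le z m i) (norm_nonneg _) (norm_nonneg _)))).trans (neg_abs_le _)
  have h2 : -(‖z - m‖ * (l * ‖z - x‖)) ≤ inner ℝ (z i - m i) (F z i - F x i) :=
    (neg_le_neg ((abs_real_inner_le_norm _ _).trans (mul_le_mul (norm_apply_sub_apply_le z m i)
      (hL.norm_block_sub_le z x i) (norm_nonneg _) (norm_nonneg _)))).trans (neg_abs_le _)
  have h3 : ‖z - m‖ * (l * ‖z - x‖) ≤ ‖z - m‖ * (l * (‖z - m‖ + ‖m - x‖)) :=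
    mul_le_mul_of_nonneg_left (mul_le_mul_of_nonneg_left
      (norm_sub_le_norm_sub_add_norm_sub z m x) hl) (norm_nonneg _)
  have h4 : 2 * (l * (‖m - x‖ * ‖z - m‖)) ≤ δ * ‖m - x‖ ^ 2 + l ^ 2 / δ * ‖z - m‖ ^ 2 := by
    have h5 : 0 ≤ (δ * ‖m - x‖ - l * ‖z - m‖) ^ 2 / δ := by positivity
    have h6 : (δ * ‖m - x‖ - l * ‖z - m‖) ^ 2 / δ
        = δ * ‖m - x‖ ^ 2 + l ^ 2 / δ * ‖z - m‖ ^ 2 - 2 * (l * (‖m - x‖ * ‖z - m‖)) := by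
      field_simp
      ring
    linarith
  rw [hsplit]
  linarith

theorem exists_sum_inner_ge (hN : 0 < N) (hμ : 0 < μ) (hl : 0 ≤ l)
    (hF : IsStronglyMonotone μ F) (hL : IsLipschitz l F) {q : Fin N → ℝ} {B : ℝ}
    (hB : ∀ i, 1 ≤ B * q i) (hB0 : 0 ≤ B) :
    ∃ C : ℝ, 0 ≤ C ∧ ∀ (x m : Profile n) (z : Fin N → Profile n),
      μ / 2 * ‖m - x‖ ^ 2 - C * ∑ i, q i * ‖z i - m‖ ^ 2
        ≤ ∑ i, inner ℝ (z i i - x i) (F (z i) i - F x i) := by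
  have hN' : (0 : ℝ) < N := Nat.cast_pos.2 hN
  -- The `N` perturbation errors together cost half of the monotonicity term.
  set δ := μ / (2 * N) with hδ
  have hδ0 : 0 < δ := by positivity
  refine ⟨(l ^ 2 / δ + l) * B, by positivity, fun x m z => ?_⟩
  have h1 := Finset.sum_le_sum fun i (_ : i ∈ Finset.univ) =>
    hL.inner_block_perturb hl x m (z i) i hδ0
  refine le_trans ?_ h1
  rw [Finset.sum_sub_distrib, Finset.sum_sub_distrib, Finset.sum_const, Finset.card_univ,
    Fintype.card_fin, nsmul_eq_mul, ← Finset.mul_sum]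
  have h2 : μ * ‖m - x‖ ^ 2 ≤ ∑ i, inner ℝ (m i - x i) (F m i - F x i) := by
    have h := hF m x
    rw [real_inner_comm, PiLp.inner_apply] at h
    exact h
  have h3 : ∑ i, ‖z i - m‖ ^ 2 ≤ B * ∑ i, q i * ‖z i - m‖ ^ 2 := by
    rw [Finset.mul_sum]
    refine Finset.sum_le_sum fun i _ => ?_
    rw [← mul_assoc]
    exact le_mul_of_one_le_left (sq_nonneg _) (hB i)
  have h4 : (N : ℝ) * (δ * ‖m - x‖ ^ 2) = μ / 2 * ‖m - x‖ ^ 2 := by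
    rw [hδ]; field_simp
  have h5 := mul_le_mul_of_nonneg_left h3 (show 0 ≤ l ^ 2 / δ + l by positivity)
  rw [h4, mul_assoc]
  linarith

/-- Agent `i` contributes its inner product with effective weight `q i * h i`, within `e` of 1.
Replacing it by 1 costs at most a multiple of `e` times the energy, where `1 ≤ B * q i` restores the
weights. -/
theorem IsVISolution.sum_norm_step_sub_sq_le (hne : ∀ i, (Ω i).Nonempty)
    (hcl : ∀ i, IsClosed (Ω i)) (hcv : ∀ i, Convex ℝ (Ω i)) (hl : 0 ≤ l)
    (hL : IsLipschitz l F) {x : Profile n} (hx : IsVISolution Ω F x)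
    {q h : Fin N → ℝ} {B H e a : ℝ} (hq : ∀ i, 0 ≤ q i) (hB : ∀ i, 1 ≤ B * q i)
    (ha : 0 ≤ a) (hh : ∀ i, 0 ≤ h i) (hH : ∀ i, h i ≤ H) (he : ∀ i, |q i * h i - 1| ≤ e)
    (z : Fin N → Profile n) :
    ∑ i, q i * ‖replaceBlock (z i) i (proj (Ω i) (z i i - (a * h i) • F (z i) i)) - x‖ ^ 2
      ≤ (1 + a * (2 * e * l * B + a * H ^ 2 * l ^ 2)) * ∑ i, q i * ‖z i - x‖ ^ 2
        - 2 * a * ∑ i, inner ℝ (z i i - x i) (F (z i) i - F x i) := by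
  rw [Finset.mul_sum, Finset.mul_sum, ← Finset.sum_sub_distrib]
  refine Finset.sum_le_sum fun i _ => ?_
  have h1 := mul_le_mul_of_nonneg_left
    (hx.norm_step_sub_sq_le hne hcl hcv hL (mul_nonneg ha (hh i)) (z i) i) (hq i)
  refine h1.trans ?_
  set p := inner ℝ (z i i - x i) (F (z i) i - F x i)
  set U := ‖z i - x‖ ^ 2 with hU
  have hU0 : 0 ≤ U := sq_nonneg _
  have he0 : 0 ≤ e := (abs_nonneg _).trans (he i)
  have hp : |p| ≤ l * (B * q i * U) := by
    calc |p| ≤ ‖z i - x‖ * (l * ‖z i - x‖) :=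
          (abs_real_inner_le_norm _ _).trans (mul_le_mul (norm_apply_sub_apply_le (z i) x i)
            (hL.norm_block_sub_le (z i) x i) (norm_nonneg _) (norm_nonneg _))
      _ = l * (1 * U) := by rw [hU]; ring
      _ ≤ _ := mul_le_mul_of_nonneg_left (mul_le_mul_of_nonneg_right (hB i) hU0) hl
  have h2 : -((q i * h i - 1) * p) ≤ e * (l * (B * q i * U)) :=
    (neg_le_abs _).trans (by
      rw [abs_mul]
      exact mul_le_mul (he i) hp (abs_nonneg _) he0)
  have h3 : h i ^ 2 ≤ H ^ 2 := pow_le_pow_left₀ (hh i) (hH i) 2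
  have h4 := mul_le_mul_of_nonneg_left h2 ha
  have h5 := mul_le_mul_of_nonneg_right h3
    (show 0 ≤ a ^ 2 * l ^ 2 * (q i * U) from
      mul_nonneg (by positivity) (mul_nonneg (hq i) hU0))
  linarith

end Game

/-! ### Energy descent and convergence. -/

/-- Here `A` is the squared distance of the mean to the equilibrium, and `P`, `R` are the
dispersions before and after mixing. The gain `c` in `R` pays for the growth `a * (μ / 2 + 2 * C)`
and leaves the decrease `μ / 2 * a`. -/
theorem descent_arithmetic {a μ C c η A P R S V : ℝ} (ha : 0 ≤ a) (hμ : 0 ≤ μ) (hC : 0 ≤ C)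
    (hc : 0 ≤ c) (hA : 0 ≤ A) (hP : 0 ≤ P) (hR : 0 ≤ R) (hRP : R ≤ (1 - c) * P)
    (hS : μ / 2 * A - C * R ≤ S) (hη : η ≤ μ / 2) (hac : a * (μ + 2 * C) ≤ c)
    (hV : V ≤ (1 + a * η) * (A + R) - 2 * a * S) : V ≤ (1 - μ / 2 * a) * (A + P) := by
  have h1 := mul_le_mul_of_nonneg_left hS (mul_nonneg zero_le_two ha)
  have h2 := mul_le_mul_of_nonneg_right (mul_le_mul_of_nonneg_left hη ha) (add_nonneg hA hR)
  have h3 : (1 + a * (μ / 2 + 2 * C)) * R ≤ (1 + a * (μ / 2 + 2 * C)) * ((1 - c) * P) :=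
    mul_le_mul_of_nonneg_left hRP (by positivity)
  have h4 := mul_le_mul_of_nonneg_right hac hP
  have h5 : 0 ≤ a * (μ / 2 + 2 * C) * (c * P) := by positivity
  linarith

theorem tendsto_iterates {N : ℕ} {n : Fin N → ℕ} {Ω : (i : Fin N) → Set (Strategy n i)}
    {J : Fin N → Profile n → ℝ} {G : Digraph (Fin N)} {W : Matrix (Fin N) (Fin N) ℝ}
    (hne : ∀ i, (Ω i).Nonempty) (hcl : ∀ i, IsClosed (Ω i)) (hcv : ∀ i, Convex ℝ (Ω i))
    {μ l : ℝ} (hμ : 0 < μ) (hl : 0 < l) (hF : IsStronglyMonotone μ (pseudoGradient J))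
    (hL : IsLipschitz l (pseudoGradient J)) (hG : IsStronglyConnected G)
    (hW : IsWeightedAdjacency G W) (hdiag : ∀ i, 0 < W i i) (hrow : ∀ i, ∑ j, W i j = 1)
    {α : ℕ → ℝ} (hα_pos : ∀ k, 0 < α k)
    (hα_sum : Tendsto (fun K => ∑ k ∈ Finset.range K, α k) atTop atTop)
    (hα_lim : Tendsto α atTop (𝓝 0)) {x : Profile n}
    (hx : IsVISolution Ω (pseudoGradient J) x) (x₀ : Fin N → Profile n) :
    Tendsto (iterates Ω J G W α x₀) atTop (𝓝 (fun _ => x)) := by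
  rcases Nat.eq_zero_or_pos N with rfl | hN
  · rw [tendsto_pi_nhds]
    exact fun i => i.elim0
  have : Nonempty (Fin N) := ⟨⟨0, hN⟩⟩
  have hnn : ∀ i j, 0 ≤ W i j := fun i j => by
    by_cases h : G.Adj i j
    · exact ((hW i j).1 h).le
    · exact ((hW i j).2 h).ge
  have hconn : ∀ i j, Relation.ReflTransGen (fun a b => 0 < W a b) i j := fun i j =>
    Relation.ReflTransGen.mono (fun a b => (hW a b).1) i j (hG i j)
  obtain ⟨q, hq⟩ := exists_isStationaryWeight hnn hrow hconn
  obtain ⟨c, hc0, hc1, hc⟩ := hq.exists_contraction (E := Profile n) hnn hdiag hrow hconn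
  obtain ⟨B, hB⟩ : ∃ B : ℝ, ∀ i, (q i)⁻¹ ≤ B :=
    ⟨∑ i, (q i)⁻¹, fun i => Finset.single_le_sum (f := fun i => (q i)⁻¹)
      (fun i _ => (inv_pos.2 (hq.pos i)).le) (Finset.mem_univ i)⟩
  have hB0 : 0 ≤ B := (inv_pos.2 (hq.pos ⟨0, hN⟩)).le.trans (hB _)
  have hBq : ∀ i, 1 ≤ B * q i := fun i => (inv_le_iff_one_le_mul₀ (hq.pos i)).1 (hB i)
  obtain ⟨C, hC0, hC⟩ := exists_sum_inner_ge hN hμ hl.le hF hL hBq hB0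
  set h : ℕ → Fin N → ℝ := fun k i => (eigvecEstimate G W k i i)⁻¹ with hh
  have hlim : ∀ i, Tendsto (fun k => h k i) atTop (𝓝 (q i)⁻¹) := fun i =>
    (tendsto_eigvecEstimate hW hq hnn hdiag hrow hconn i i).inv₀ (hq.pos i).ne'
  set e : ℕ → ℝ := fun k => ∑ i, |q i * h k i - 1| with he
  have he_lim : Tendsto e atTop (𝓝 0) := by
    have : Tendsto e atTop (𝓝 (∑ i : Fin N, |q i * (q i)⁻¹ - 1|)) :=
      tendsto_finsetSum _ fun i _ => (((hlim i).const_mul (q i)).sub_const 1).abs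
    simpa [fun i => mul_inv_cancel₀ (hq.pos i).ne'] using this
  set X := iterates Ω J G W α x₀ with hX
  set z : ℕ → Fin N → Profile n := fun k i => ∑ j, W i j • X k j with hz
  have hXstep : ∀ k i, X (k + 1) i = replaceBlock (z k i) i
      (proj (Ω i) (z k i i - (α k * h k i) • pseudoGradient J (z k i) i)) := fun k i => by
    have : z k i = mixedEstimate G W (X k) i := (sum_inNeighbors_smul hW (X k) i).symm
    rw [this]
    rfl
  set V : ℕ → ℝ := fun k => ∑ i, q i * ‖X k i - x‖ ^ 2 with hV
  have hV0 : ∀ k, 0 ≤ V k := fun k =>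
    Finset.sum_nonneg fun i _ => mul_nonneg (hq.pos i).le (sq_nonneg _)
  have hpos_ev : ∀ᶠ k in atTop, ∀ i, 0 ≤ h k i := eventually_all.2 fun i =>
    ((hlim i).eventually_const_lt (inv_pos.2 (hq.pos i))).mono fun k hk => hk.le
  have hbound_ev : ∀ᶠ k in atTop, ∀ i, h k i ≤ B + 1 := eventually_all.2 fun i =>
    ((hlim i).eventually_lt_const (by linarith [hB i])).mono fun k hk => hk.le
  have hsmall : ∀ᶠ k in atTop, 2 * e k * l * B + α k * (B + 1) ^ 2 * l ^ 2 < μ / 2 := by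
    refine Tendsto.eventually_lt_const (half_pos hμ) (v := 0) ?_
    have := (((he_lim.const_mul 2).mul_const l).mul_const B).add
      ((hα_lim.mul_const ((B + 1) ^ 2)).mul_const (l ^ 2))
    simpa using this
  have hstep_ev : ∀ᶠ k in atTop, α k * (μ + 2 * C) < c := by
    refine Tendsto.eventually_lt_const hc0 (v := 0) ?_
    simpa using hα_lim.mul_const (μ + 2 * C)
  have hdesc : ∀ᶠ k in atTop, V (k + 1) ≤ (1 - μ / 2 * α k) * V k := by
    filter_upwards [hpos_ev, hbound_ev, hsmall, hstep_ev] with k hk1 hk2 hk3 hk4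
    have ha := (hα_pos k).le
    set m := ∑ j, q j • X k j with hm
    have hmz : ∑ j, q j • z k j = m := hq.mean_step _
    -- Used for both `X k` and `z k`: mixing preserves `m`, so only the dispersion changes.
    have hcent : ∀ y : Fin N → Profile n, ∑ j, q j • y j = m →
        ∑ i, q i * ‖y i - x‖ ^ 2 = ‖m - x‖ ^ 2 + ∑ i, q i * ‖y i - m‖ ^ 2 := fun y hy => by
      have h1 := sum_mul_norm_sub_mean_sq hq.sum_eq (fun i => y i - x)
      have h2 : ∑ j, q j • (y j - x) = m - x := by
        simp_rw [smul_sub, Finset.sum_sub_distrib, ← Finset.sum_smul, hq.sum_eq, one_smul, hy]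
      simp_rw [h2, sub_sub_sub_cancel_right] at h1
      linarith
    have h1 := hx.sum_norm_step_sub_sq_le hne hcl hcv hl.le hL (fun i => (hq.pos i).le) hBq ha
      hk1 hk2 (fun i => Finset.single_le_sum (f := fun i => |q i * h k i - 1|)
        (fun i _ => abs_nonneg _) (Finset.mem_univ i)) (z k)
    have h2 := hC x m (z k)
    have h3 : ∑ i, q i * ‖z k i - m‖ ^ 2 ≤ (1 - c) * ∑ i, q i * ‖X k i - m‖ ^ 2 := hc (X k)
    have hVk : V k = ‖m - x‖ ^ 2 + ∑ i, q i * ‖X k i - m‖ ^ 2 := hcent (X k) rfl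
    have hVk1 : V (k + 1) = ∑ i, q i * ‖replaceBlock (z k i) i (proj (Ω i)
        (z k i i - (α k * h k i) • pseudoGradient J (z k i) i)) - x‖ ^ 2 := by
      simp only [hV, hXstep]
    rw [← hVk1, hcent (z k) hmz] at h1
    rw [hVk]
    exact descent_arithmetic ha hμ.le hC0 hc0.le (sq_nonneg _)
      (Finset.sum_nonneg fun i _ => mul_nonneg (hq.pos i).le (sq_nonneg _))
      (Finset.sum_nonneg fun i _ => mul_nonneg (hq.pos i).le (sq_nonneg _)) h3 h2 hk3.le hk4.le h1
  have hVlim := tendsto_zero_of_eventually_le_one_sub_mul (half_pos hμ) hV0 hdesc hα_sum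
  rw [tendsto_pi_nhds]
  intro i
  have hsq : Tendsto (fun k => ‖X k i - x‖ ^ 2) atTop (𝓝 0) := by
    refine squeeze_zero (fun k => sq_nonneg _) (fun k => ?_)
      (by simpa using hVlim.const_mul (q i)⁻¹)
    rw [le_inv_mul_iff₀ (hq.pos i)]
    exact Finset.single_le_sum (f := fun i => q i * ‖X k i - x‖ ^ 2)
      (fun i _ => mul_nonneg (hq.pos i).le (sq_nonneg _)) (Finset.mem_univ i)
  rw [tendsto_iff_norm_sub_tendsto_zero]
  simpa using hsq.sqrt

theorem theorem3 {N : ℕ} (n : Fin N → ℕ)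
    (Ω : (i : Fin N) → Set (Strategy n i)) (J : Fin N → Profile n → ℝ)
    (G : Digraph (Fin N)) (W : Matrix (Fin N) (Fin N) ℝ)
    (hΩ_nonempty : ∀ i, (Ω i).Nonempty)
    (hΩ_closed : ∀ i, IsClosed (Ω i))
    (hΩ_convex : ∀ i, Convex ℝ (Ω i))
    (hJ_cont : ∀ i, Continuous (J i))
    (hJ_convex : ∀ i (x : Profile n),
      ConvexOn ℝ Set.univ (fun y : Strategy n i => J i (replaceBlock x i y)))
    (hJ_diff : ∀ i (x : Profile n),
      ContDiff ℝ 1 (fun y : Strategy n i => J i (replaceBlock x i y)))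
    (hF_mono : ∃ μ : ℝ, 0 < μ ∧ IsStronglyMonotone μ (pseudoGradient J))
    (hF_lip : ∃ l : ℝ, 0 < l ∧ IsLipschitz l (pseudoGradient J))
    (hG : IsStronglyConnected G)
    (hW : IsWeightedAdjacency G W)
    (hW_loops : ∀ i, 0 < W i i)
    (hW_row : ∀ i, ∑ j, W i j = 1)
    (α : ℕ → ℝ)
    (hα_pos : ∀ k, 0 < α k)
    (hα_anti : Antitone α)
    (hα_sum : Tendsto (fun K => ∑ k ∈ Finset.range K, α k) atTop atTop)
    (hα_lim : Tendsto α atTop (𝓝 0)) :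
    ∃ xstar : Profile n,
      (IsNashEquilibrium Ω J xstar ∧ ∀ y, IsNashEquilibrium Ω J y → y = xstar) ∧
      ∀ x₀ : Fin N → Profile n, (∀ i, x₀ i i ∈ Ω i) →
        Tendsto (iterates Ω J G W α x₀) atTop (𝓝 (fun _ => xstar)) := by
  obtain ⟨μ, hμ, hF⟩ := hF_mono
  obtain ⟨l, hl, hL⟩ := hF_lip
  have hiff := isNashEquilibrium_iff_isVISolution hΩ_convex hJ_convex hJ_diff
  obtain ⟨x, hx⟩ := exists_isVISolution hΩ_nonempty hΩ_closed hΩ_convex hμ hl hF hL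
  exact ⟨x, ⟨(hiff x).2 hx, fun y hy => ((hiff y).1 hy).eq hμ hF hx⟩, fun x₀ _ =>
    tendsto_iterates hΩ_nonempty hΩ_closed hΩ_convex hμ hl hF hL hG hW hW_loops hW_row
      hα_pos hα_sum hα_lim hx x₀⟩
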